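/- Let $\mathbb H$ be the algebra of quaternions and let $\mathbb S=\{I\in\mathbb H:\ \mathrm{Re}\,I=0,\ |I|=1\}$. For $I\in\mathbb S$ put $L_I=\mathbb R+I\mathbb R$, identified with $\mathbb C$ through $x+Iy\leftrightarrow x+iy$. Let $V$ be a bilateral quaternionic Banach space, that is, a real Banach space with commuting left and right $\mathbb H$-vector space structures, both extending the real one, such that $\|av\|=|a|\,\|v\|=\|va\|$ for $a\in\mathbb H$, $v\in V$. Let $\mathcal B(V)$ be the Banach space of bounded right linear operators on $V$ with the operator norm, where $(Ta)(v)=T(av)$ and $(a\mathcal I)(v)=av$ for $a\in\mathbb H$. For $T\in\mathcal B(V)$ let $$\sigma_S(T)=\{s\in\mathbb H:\ T^2-2\,\mathrm{Re}[s]\,T+|s|^2\mathcal I\ \text{ is not invertible in } \mathcal B(V)\}$$ be its $S$-spectrum, and for $s\notin\sigma_S(T)$ let $$S^{-1}(s,T)=-(T^2-2\,\mathrm{Re}[s]\,T+|s|^2\mathcal I)^{-1}(T-\overline s\,\mathcal I).$$ A function $f$ is (left) regular on an open ball $B(0,R)\subset\mathbb H$ if it is real differentiable there and, for every $I\in\mathbb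 S$, $\frac12\big(\frac{\partial}{\partial x}+I\frac{\partial}{\partial y}\big)f(x+Iy)=0$ at all points $x+Iy\in B(0,R)$. For a bounded open set $U\subset L_I$, an oriented boundary of $U$ is a finite family of closed rectifiable curves in $L_I\cong\mathbb C$, given by Lipschitz parametrizations on $[0,1]$, whose traces have union $\partial U$ (the topological boundary in $L_I$) and whose total winding number is $1$ about each point of $U$ and $0$ about each point of $L_I\setminus\overline U$. Integrals over $\partial U$ are taken along such a family, and $ds_I=-I\,ds$. **Theorem.** Let $T\in\mathcal B(V)$, let $R>0$ with $\sigma_S(T)\subset B(0,R)$, and let $f:\mathbb H\to\mathbb H$ be regular on $B(0,R)$. For $I\in\mathbb S$, call $U\subset L_I$ admissible if it is open in $L_I$, bounded, contains $L_I\cap\sigma_S(T)$, and $\overline U\subset B(0,R)$. Then: 1. for every $I\in\mathbb S$ there is an admissible $U\subset L_I$ that has an oriented boundary; 2. for every $I\in\mathbb S$ and every admissible $U\subset L_I$ with an oriented boundary, the integrand of $$\frac1{2\pi}\int_{\partial U}S^{-1}(s,T)\,ds_I\,f(s)$$ is integrable along each boundary curve, so the integral exists as an element of $\mathcal B(V)$;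 3. the value of this integral depends neither on $I$, nor on $U$, nor on the choice of the oriented boundary: for all $I,I'\in\mathbb S$ and all admissible $U\subset L_I$, $U'\subset L_{I'}$ with oriented boundaries, $$\frac1{2\pi}\int_{\partial U}S^{-1}(s,T)\,ds_I\,f(s)=\frac1{2\pi}\int_{\partial U'}S^{-1}(s,T)\,ds_{I'}\,f(s).$$ In particular, $f(T)$, defined as this common value, is well defined. -/

import Mathlib

open Set MeasureTheory Metric
open scoped Quaternion MulOpposite

noncomputable section

namespace SCalculus

/-! ## Quaternions, slices and regular functions -/

/-- The sphere of purely imaginary unit quaternions. -/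
def imagUnits : Set ℍ[ℝ] := {I | I.re = 0 ∧ ‖I‖ = 1}

/-- The identification `x + i y ↦ x + I y` of the complex plane with the slice
`L_I = ℝ + I ℝ`. -/
def slice (I : ℍ[ℝ]) (z : ℂ) : ℍ[ℝ] := (z.re : ℍ[ℝ]) + I * (z.im : ℍ[ℝ])

/-- Left (slice) regularity on an open set `B`: `f` is real differentiable on `B` and, for every
imaginary unit `I`, the restriction `f_I` of `f` to the slice `L_I` satisfies
`(1/2) (∂/∂x + I ∂/∂y) f_I (x + I y) = 0` at all points `x + I y` of `B`. -/
def IsLeftRegularOn (f : ℍ[ℝ] → ℍ[ℝ]) (B : Set ℍ[ℝ]) : Prop :=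
  DifferentiableOn ℝ f B ∧
    ∀ I ∈ imagUnits, ∀ x y : ℝ, slice I ⟨x, y⟩ ∈ B →
      (1 / 2 : ℝ) • (deriv (fun x' : ℝ => f (slice I ⟨x', y⟩)) x
        + I * deriv (fun y' : ℝ => f (slice I ⟨x, y'⟩)) y) = 0

/-! ## Bounded right linear operators on a bilateral quaternionic Banach space -/

section Operators

variable {V : Type*} [NormedAddCommGroup V] [NormedSpace ℝ V]
  [Module ℍ[ℝ] V] [Module ℍ[ℝ]ᵐᵒᵖ V]
  [IsScalarTower ℝ ℍ[ℝ] V] [IsScalarTower ℝ ℍ[ℝ]ᵐᵒᵖ V]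
  [SMulCommClass ℍ[ℝ]ᵐᵒᵖ ℍ[ℝ] V]
  [NormSMulClass ℍ[ℝ] V] [NormSMulClass ℍ[ℝ]ᵐᵒᵖ V]

/-- A bounded right linear operator, viewed as a bounded real linear operator. -/
def toReal : (V →L[ℍ[ℝ]ᵐᵒᵖ] V) →+* (V →L[ℝ] V) where
  toFun T := T.restrictScalars ℝ
  map_one' := rfl
  map_mul' _ _ := rfl
  map_zero' := rfl
  map_add' _ _ := rfl

theorem toReal_injective :
    Function.Injective (toReal : (V →L[ℍ[ℝ]ᵐᵒᵖ] V) →+* (V →L[ℝ] V)) := by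
  intro S T h
  ext v
  exact DFunLike.congr_fun h v

/-- `toReal` as a real linear map. -/
def toRealLin : (V →L[ℍ[ℝ]ᵐᵒᵖ] V) →ₗ[ℝ] (V →L[ℝ] V) where
  toFun T := toReal T
  map_add' _ _ := rfl
  map_smul' _ _ := rfl

/-- The ring of bounded right linear operators with the operator norm
`sup {‖T v‖ : ‖v‖ ≤ 1}`. -/
instance : NormedRing (V →L[ℍ[ℝ]ᵐᵒᵖ] V) :=
  NormedRing.induced (V →L[ℍ[ℝ]ᵐᵒᵖ] V) (V →L[ℝ] V) toReal toReal_injective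

instance : NormedSpace ℝ (V →L[ℍ[ℝ]ᵐᵒᵖ] V) :=
  NormedSpace.induced ℝ (V →L[ℍ[ℝ]ᵐᵒᵖ] V) (V →L[ℝ] V) toRealLin

theorem norm_eq (T : V →L[ℍ[ℝ]ᵐᵒᵖ] V) : ‖T‖ = ‖T.restrictScalars ℝ‖ := rfl

instance [CompleteSpace V] : CompleteSpace (V →L[ℍ[ℝ]ᵐᵒᵖ] V) := by
  have hiso : Isometry (toReal : (V →L[ℍ[ℝ]ᵐᵒᵖ] V) → (V →L[ℝ] V)) :=
    Isometry.of_dist_eq fun _ _ => rfl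
  have hr : Set.range (toReal : (V →L[ℍ[ℝ]ᵐᵒᵖ] V) → (V →L[ℝ] V))
      = ⋂ (a : ℍ[ℝ]ᵐᵒᵖ) (v : V), {A : V →L[ℝ] V | A (a • v) = a • A v} := by
    ext A
    simp only [Set.mem_range, Set.mem_iInter, Set.mem_ofPred_eq]
    constructor
    · rintro ⟨T, rfl⟩ a v
      exact T.map_smul a v
    · intro h
      exact ⟨{ toFun := A, map_add' := A.map_add, map_smul' := h, cont := A.cont },
        by ext v; rfl⟩
  have hc : IsClosed (Set.range (toReal : (V →L[ℍ[ℝ]ᵐᵒᵖ] V) → (V →L[ℝ] V))) := by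
    rw [hr]
    refine isClosed_iInter fun a => isClosed_iInter fun v => isClosed_eq ?_ ?_
    · exact (ContinuousLinearMap.apply ℝ V (a • v)).continuous
    · exact (ContinuousLinearMap.apply ℝ V v).continuous.const_smul a
  exact (completeSpace_iff_isComplete_range hiso.isUniformInducing).2 hc.isComplete

/-- The operator `a 𝓘 : v ↦ a v`. Since `(T a) v = T (a v)`, the product `T a` of an operator
with a quaternion on the right is `T * scalarOp a`. -/
def scalarOp (a : ℍ[ℝ]) : V →L[ℍ[ℝ]ᵐᵒᵖ] V := a • (1 : V →L[ℍ[ℝ]ᵐᵒᵖ] V)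

theorem scalarOp_apply (a : ℍ[ℝ]) (v : V) : (scalarOp a : V →L[ℍ[ℝ]ᵐᵒᵖ] V) v = a • v := rfl

/-- `T² - 2 Re[s] T + |s|² 𝓘`. -/
def quadOp (T : V →L[ℍ[ℝ]ᵐᵒᵖ] V) (s : ℍ[ℝ]) : V →L[ℍ[ℝ]ᵐᵒᵖ] V :=
  T ^ 2 - (2 * s.re) • T + (‖s‖ ^ 2) • (1 : V →L[ℍ[ℝ]ᵐᵒᵖ] V)

/-- The `S`-spectrum. -/
def sSpectrum (T : V →L[ℍ[ℝ]ᵐᵒᵖ] V) : Set ℍ[ℝ] := {s | ¬ IsUnit (quadOp T s)}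

/-- The `S`-resolvent operator `-(T² - 2 Re[s] T + |s|² 𝓘)⁻¹ (T - s̄ 𝓘)`
(meaningful for `s` outside the `S`-spectrum). -/
def sResolvent (s : ℍ[ℝ]) (T : V →L[ℍ[ℝ]ᵐᵒᵖ] V) : V →L[ℍ[ℝ]ᵐᵒᵖ] V :=
  -(Ring.inverse (quadOp T s) * (T - scalarOp (star s)))

end Operators

/-! ## Boundaries of plane open sets and the Cauchy integral -/

/-- The positively oriented boundary `∂U` of a plane open set `U`: finitely many closed rectifiable
curves (with Lipschitz parametrizations on `[0, 1]`) whose traces together make up the topological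
boundary of `U`, and whose total winding number is `1` about each point of `U` and `0` about each
point outside the closure of `U`. -/
structure OrientedBoundary (U : Set ℂ) where
  /-- the number of curves -/
  n : ℕ
  /-- the curves -/
  γ : Fin n → ℝ → ℂ
  lipschitz : ∀ k, ∃ K, LipschitzOnWith K (γ k) (Icc 0 1)
  closed : ∀ k, γ k 0 = γ k 1
  trace : ⋃ k, γ k '' Icc 0 1 = frontier U
  index_inside : ∀ a ∈ U,
    (2 * Real.pi * Complex.I)⁻¹ * ∑ k, ∫ t in (0 : ℝ)..1, (γ k t - a)⁻¹ * deriv (γ k) t = 1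
  index_outside : ∀ a ∉ closure U,
    (2 * Real.pi * Complex.I)⁻¹ * ∑ k, ∫ t in (0 : ℝ)..1, (γ k t - a)⁻¹ * deriv (γ k) t = 0

section Integral

variable {V : Type*} [NormedAddCommGroup V] [NormedSpace ℝ V]
  [Module ℍ[ℝ] V] [Module ℍ[ℝ]ᵐᵒᵖ V]
  [IsScalarTower ℝ ℍ[ℝ] V] [IsScalarTower ℝ ℍ[ℝ]ᵐᵒᵖ V]
  [SMulCommClass ℍ[ℝ]ᵐᵒᵖ ℍ[ℝ] V]
  [NormSMulClass ℍ[ℝ] V] [NormSMulClass ℍ[ℝ]ᵐᵒᵖ V]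

/-- `U`, read as the subset `{x + I y | x + i y ∈ U}` of the slice `L_I`, is a bounded open set
which contains `L_I ∩ σ_S(T)` and whose closure lies in the ball `B(0, R)`. -/
structure IsAdmissible (T : V →L[ℍ[ℝ]ᵐᵒᵖ] V) (R : ℝ) (I : ℍ[ℝ]) (U : Set ℂ) : Prop where
  isOpen : IsOpen U
  isBounded : Bornology.IsBounded U
  spectrum_subset : ∀ z, slice I z ∈ sSpectrum T → z ∈ U
  closure_subset : ∀ z ∈ closure U, slice I z ∈ ball (0 : ℍ[ℝ]) R

/-- The pull-back of `S⁻¹(s, T) ds_I f(s)`, where `ds_I = -I ds`, along the curve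
`s = x(t) + I y(t)` in `L_I` with `γ t = x(t) + i y(t)`. -/
def cauchyIntegrand (T : V →L[ℍ[ℝ]ᵐᵒᵖ] V) (f : ℍ[ℝ] → ℍ[ℝ]) (I : ℍ[ℝ]) (γ : ℝ → ℂ) (t : ℝ) :
    V →L[ℍ[ℝ]ᵐᵒᵖ] V :=
  sResolvent (slice I (γ t)) T * scalarOp ((-I * slice I (deriv γ t)) * f (slice I (γ t)))

/-- `(1 / 2π) ∫_{∂U} S⁻¹(s, T) ds_I f(s)`. -/
def cauchyIntegral (T : V →L[ℍ[ℝ]ᵐᵒᵖ] V) (f : ℍ[ℝ] → ℍ[ℝ]) (I : ℍ[ℝ]) {U : Set ℂ}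
    (Γ : OrientedBoundary U) : V →L[ℍ[ℝ]ᵐᵒᵖ] V :=
  (1 / (2 * Real.pi)) • ∑ k, ∫ t in (0 : ℝ)..1, cauchyIntegrand T f I (Γ.γ k) t

end Integral

end SCalculus

end

/-!
On the ball, `f` is given on every slice by a power series `f s = ∑ sⁿ aₙ` whose coefficients do not
depend on the slice, because all slices share the real axis. For `I ∈ 𝕊`, the operators
`A ↦ A ((x + I y) 𝓘)` make `𝓑(V)` a complex Banach space on which left multiplication by `T` is
complex linear. Since `T² - 2 Re[z] T + |z|²` splits over `ℂ` as `(T - z) (T - z̄)`, the operator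
`S⁻¹(s, T)` is the value at `𝓘` of the ordinary resolvent of that complex linear map. For the
resolvent `ρ` of an element `b` of a complex Banach algebra, the Cauchy transform of `ρ` along `∂U`
inside `U` and a multiple of `ρ` outside the spectrum glue to an entire function that vanishes at
infinity; by Liouville's theorem this gives `∮ zⁿ ρ(z) dz = 2πi bⁿ` for every oriented boundary.
Summing over `n` by dominated convergence, the integral equals `∑ Tⁿ aₙ`, in which neither `I` nor
`U` occurs.
-/

noncomputable section

namespace SCalculus

open Filter Topology Interval

/-! ## Lipschitz curves -/

section LipschitzCurves

theorem ae_uIcc_mem_nhds (a b : ℝ) : ∀ᵐ t : ℝ, t ∈ Ι a b → uIcc a b ∈ 𝓝 t := by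
  have ne_max : ∀ᵐ t : ℝ, t ≠ max a b := by simp [ae_iff, measure_singleton]
  filter_upwards [ne_max] with t ht htab
  exact Icc_mem_nhds htab.1 (lt_of_le_of_ne htab.2 ht)

variable {E F : Type*} [NormedAddCommGroup E] [NormedSpace ℝ E]
  [NormedAddCommGroup F] [NormedSpace ℝ F] {a b : ℝ} {K : NNReal}

theorem ae_norm_deriv_le {f : ℝ → E} (hf : LipschitzOnWith K f (uIcc a b)) :
    ∀ᵐ t : ℝ, t ∈ Ι a b → ‖deriv f t‖ ≤ K := by
  filter_upwards [ae_uIcc_mem_nhds a b] with t hnhds ht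
  exact norm_deriv_le_of_lipschitzOn (hnhds ht) hf

theorem ae_differentiableAt [FiniteDimensional ℝ E] {f : ℝ → E}
    (hf : LipschitzOnWith K f (uIcc a b)) :
    ∀ᵐ t : ℝ, t ∈ Ι a b → DifferentiableAt ℝ f t := by
  filter_upwards [hf.ae_differentiableWithinAt_of_mem_real, ae_uIcc_mem_nhds a b]
    with t hdiff hnhds ht
  exact (hdiff (uIoc_subset_uIcc ht)).differentiableAt (hnhds ht)

theorem intervalIntegrable_apply_deriv [CompleteSpace E] {γ : ℝ → E}
    (hγ : LipschitzOnWith K γ (uIcc a b)) {ω : ℝ → E →L[ℝ] F} (hω : ContinuousOn ω (uIcc a b)) :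
    IntervalIntegrable (fun t => ω t (deriv γ t)) volume a b := by
  obtain ⟨C, hC⟩ := isCompact_uIcc.exists_bound_of_continuousOn hω
  have hmeas : AEStronglyMeasurable (fun t => ω t (deriv γ t)) (volume.restrict (Ι a b)) :=
    (ContinuousLinearMap.id ℝ (E →L[ℝ] F)).aestronglyMeasurable_comp₂
      ((hω.mono uIoc_subset_uIcc).aestronglyMeasurable measurableSet_uIoc)
      (stronglyMeasurable_deriv γ).aestronglyMeasurable
  refine (intervalIntegrable_const (c := C * K)).mono_fun hmeas ?_
  rw [EventuallyLE, ae_restrict_iff' measurableSet_uIoc]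
  filter_upwards [ae_norm_deriv_le hγ] with t hderiv ht
  exact ((ω t).le_of_opNorm_le_of_le (hC t (uIoc_subset_uIcc ht)) (hderiv ht)).trans
    (le_abs_self _)

theorem integral_eq_sub_of_lipschitzOnWith [CompleteSpace E] {f f' : ℝ → E}
    (hf : LipschitzOnWith K f (uIcc a b)) (hderiv : ∀ᵐ t, t ∈ Ι a b → HasDerivAt f (f' t) t)
    (hint : IntervalIntegrable f' volume a b) : ∫ t in a..b, f' t = f b - f a := by
  refine (SeparatingDual.eq_iff_forall_dual_eq (R := ℝ)).2 fun ℓ => ?_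
  have hℓf : LipschitzOnWith (‖ℓ‖₊ * K) (fun t => ℓ (f t)) (uIcc a b) :=
    ℓ.lipschitz.comp_lipschitzOnWith hf
  calc ℓ (∫ t in a..b, f' t)
      = ∫ t in a..b, ℓ (f' t) := (ℓ.intervalIntegral_comp_comm hint).symm
    _ = ∫ t in a..b, deriv (fun t => ℓ (f t)) t := by
        refine intervalIntegral.integral_congr_ae ?_
        filter_upwards [hderiv] with t ht htab
        exact (ℓ.hasFDerivAt.comp_hasDerivAt t (ht htab)).deriv.symm
    _ = ℓ (f b) - ℓ (f a) := hℓf.absolutelyContinuousOnInterval.integral_deriv_eq_sub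
    _ = ℓ (f b - f a) := (map_sub ℓ _ _).symm

theorem integral_fderiv_apply_deriv_eq_sub [FiniteDimensional ℝ E] [CompleteSpace F] {γ : ℝ → E}
    (hγ : LipschitzOnWith K γ (uIcc a b)) {g : E → F} (hg : ContDiff ℝ 1 g) :
    ∫ t in a..b, fderiv ℝ g (γ t) (deriv γ t) = g (γ b) - g (γ a) := by
  have : CompleteSpace E := FiniteDimensional.complete ℝ E
  obtain ⟨C, hC⟩ := LocallyLipschitzOn.exists_lipschitzOnWith_of_compact
    (isCompact_uIcc.image_of_continuousOn hγ.continuousOn)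
    hg.locallyLipschitz.locallyLipschitzOn
  refine integral_eq_sub_of_lipschitzOnWith (hC.comp hγ (mapsTo_image _ _)) ?_
    (intervalIntegrable_apply_deriv hγ
      ((hg.continuous_fderiv one_ne_zero).comp_continuousOn hγ.continuousOn))
  filter_upwards [ae_differentiableAt hγ] with t hdiff ht
  exact (hg.differentiable one_ne_zero _).hasFDerivAt.comp_hasDerivAt t (hdiff ht).hasDerivAt

end LipschitzCurves

/-! ## The Cauchy transform of a curve -/

section CauchyTransform

variable {E : Type*} [NormedAddCommGroup E] [NormedSpace ℂ E] {a b : ℝ}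

theorem differentiableAt_integral_inv_sub_smul {γ : ℝ → ℂ} (hγ : ContinuousOn γ (uIcc a b))
    {G : ℝ → E} (hG : IntervalIntegrable G volume a b) {z₀ : ℂ} (hz₀ : z₀ ∉ γ '' uIcc a b) :
    DifferentiableAt ℂ (fun z => ∫ t in a..b, (γ t - z)⁻¹ • G t) z₀ := by
  obtain ⟨ε, hε, hball⟩ := Metric.isOpen_iff.1
    (isCompact_uIcc.image_of_continuousOn hγ).isClosed.isOpen_compl z₀ hz₀
  have hfar : ∀ t ∈ uIcc a b, ∀ z ∈ ball z₀ (ε / 2), ε / 2 ≤ ‖γ t - z‖ := by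
    intro t ht z hz
    have hε_le : ε ≤ dist (γ t) z₀ :=
      not_lt.1 fun h => hball (mem_ball.2 h) (mem_image_of_mem _ ht)
    rw [← dist_eq_norm]
    linarith [dist_triangle (γ t) z z₀, mem_ball.1 hz]
  have hne : ∀ t ∈ uIcc a b, ∀ z ∈ ball z₀ (ε / 2), γ t - z ≠ 0 := fun t ht z hz =>
    norm_pos_iff.1 ((half_pos hε).trans_le (hfar t ht z hz))
  have hcont : ∀ z ∈ ball z₀ (ε / 2), ContinuousOn (fun t => (γ t - z)⁻¹) (uIcc a b) :=
    fun z hz => (hγ.sub continuousOn_const).inv₀ fun t ht => hne t ht z hz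
  have hz₀_mem : z₀ ∈ ball z₀ (ε / 2) := mem_ball_self (half_pos hε)
  refine (intervalIntegral.hasDerivAt_integral_of_dominated_loc_of_deriv_le
    (F' := fun z t => ((γ t - z)⁻¹ ^ 2) • G t) (bound := fun t => ((ε / 2)⁻¹) ^ 2 * ‖G t‖)
    (ball_mem_nhds z₀ (half_pos hε)) ?_ (hG.continuousOn_smul (hcont z₀ hz₀_mem))
    (hG.continuousOn_smul ((hcont z₀ hz₀_mem).pow 2)).aestronglyMeasurable_restrict_uIoc
    ?_ (hG.norm.const_mul _) ?_).2.differentiableAt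
  · filter_upwards [ball_mem_nhds z₀ (half_pos hε)] with z hz
    exact (hG.continuousOn_smul (hcont z hz)).aestronglyMeasurable_restrict_uIoc
  · refine ae_of_all _ fun t ht z hz => ?_
    rw [norm_smul, norm_pow, norm_inv]
    gcongr
    exact hfar t (uIoc_subset_uIcc ht) z hz
  · refine ae_of_all _ fun t ht z hz => HasDerivAt.smul_const ?_ (G t)
    simpa using! ((hasDerivAt_id z).const_sub (γ t)).inv (hne t (uIoc_subset_uIcc ht) z hz)

end CauchyTransform

/-! ## Integration along an oriented boundary -/

namespace OrientedBoundary

variable {U : Set ℂ} (Γ : OrientedBoundary U)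

theorem mem_frontier (k : Fin Γ.n) {t : ℝ} (ht : t ∈ uIcc (0 : ℝ) 1) : Γ.γ k t ∈ frontier U := by
  rw [uIcc_of_le zero_le_one] at ht
  exact Γ.trace ▸ mem_iUnion.2 ⟨k, mem_image_of_mem _ ht⟩

theorem exists_lipschitzOnWith (k : Fin Γ.n) :
    ∃ K, LipschitzOnWith K (Γ.γ k) (uIcc (0 : ℝ) 1) := by
  simpa only [uIcc_of_le zero_le_one] using Γ.lipschitz k

theorem continuousOn (k : Fin Γ.n) : ContinuousOn (Γ.γ k) (uIcc (0 : ℝ) 1) :=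
  (Γ.exists_lipschitzOnWith k).choose_spec.continuousOn

section RealForms

variable {E F : Type*} [NormedAddCommGroup E] [NormedSpace ℝ E]
  [NormedAddCommGroup F] [NormedSpace ℝ F]

/-- The integral of the real differential form `ω` along the curves of `Γ`. -/
def integral (ω : ℂ → ℂ →L[ℝ] E) : E :=
  ∑ k, ∫ t in (0 : ℝ)..1, ω (Γ.γ k t) (deriv (Γ.γ k) t)

variable {Γ}

theorem intervalIntegrable {ω : ℂ → ℂ →L[ℝ] E} (hω : ContinuousOn ω (frontier U)) (k : Fin Γ.n) :
    IntervalIntegrable (fun t => ω (Γ.γ k t) (deriv (Γ.γ k) t)) volume 0 1 :=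
  intervalIntegrable_apply_deriv (Γ.exists_lipschitzOnWith k).choose_spec
    (hω.comp (Γ.continuousOn k) fun _ => Γ.mem_frontier k)

theorem integral_congr {ω ω' : ℂ → ℂ →L[ℝ] E} (h : EqOn ω ω' (frontier U)) :
    Γ.integral ω = Γ.integral ω' :=
  Finset.sum_congr rfl fun k _ => intervalIntegral.integral_congr fun t ht => by
    simp only [h (Γ.mem_frontier k ht)]

theorem integral_sub {ω ω' : ℂ → ℂ →L[ℝ] E} (hω : ContinuousOn ω (frontier U))
    (hω' : ContinuousOn ω' (frontier U)) :
    Γ.integral (fun z => ω z - ω' z) = Γ.integral ω - Γ.integral ω' := by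
  simp only [integral, ← Finset.sum_sub_distrib]
  exact Finset.sum_congr rfl fun k _ =>
    intervalIntegral.integral_sub (intervalIntegrable hω k) (intervalIntegrable hω' k)

variable (Γ) in
theorem hasSum_integral {ι : Type*} [Countable ι] {ω : ι → ℂ → ℂ →L[ℝ] E}
    {ω' : ℂ → ℂ →L[ℝ] E} {u : ι → ℝ} (hω : ∀ i, ContinuousOn (ω i) (frontier U))
    (hu : Summable u) (hle : ∀ i, ∀ z ∈ frontier U, ‖ω i z‖ ≤ u i)
    (hsum : ∀ z ∈ frontier U, HasSum (fun i => ω i z) (ω' z)) :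
    HasSum (fun i => Γ.integral (ω i)) (Γ.integral ω') := by
  refine hasSum_sum fun k _ => ?_
  obtain ⟨K, hK⟩ := Γ.exists_lipschitzOnWith k
  have mem_frontier : ∀ t ∈ Ι (0 : ℝ) 1, Γ.γ k t ∈ frontier U := fun t ht =>
    Γ.mem_frontier k (uIoc_subset_uIcc ht)
  refine intervalIntegral.hasSum_integral_of_dominated_convergence (fun i _ => u i * K)
    (fun i => (intervalIntegrable (hω i) k).aestronglyMeasurable_restrict_uIoc) (fun i => ?_)
    (ae_of_all _ fun _ _ => hu.mul_right _) intervalIntegrable_const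
    (ae_of_all _ fun t ht => ?_)
  · filter_upwards [ae_norm_deriv_le hK] with t hderiv ht
    exact (ω i (Γ.γ k t)).le_of_opNorm_le_of_le (hle i _ (mem_frontier t ht)) (hderiv ht)
  · exact (hsum _ (mem_frontier t ht)).mapL (ContinuousLinearMap.apply ℝ E (deriv (Γ.γ k) t))

variable [CompleteSpace E] [CompleteSpace F]

theorem integral_clm_comp (L : E →L[ℝ] F) {ω : ℂ → ℂ →L[ℝ] E} (hω : ContinuousOn ω (frontier U)) :
    Γ.integral (fun z => L ∘L ω z) = L (Γ.integral ω) := by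
  rw [integral, integral, map_sum]
  exact Finset.sum_congr rfl fun k _ => L.intervalIntegral_comp_comm (intervalIntegrable hω k)

variable (Γ)

theorem integral_fderiv_eq_zero {g : ℂ → E} (hg : ContDiff ℝ 1 g) :
    Γ.integral (fderiv ℝ g) = 0 :=
  Finset.sum_eq_zero fun k _ => by
    obtain ⟨K, hK⟩ := Γ.exists_lipschitzOnWith k
    rw [integral_fderiv_apply_deriv_eq_sub hK hg, Γ.closed k, sub_self]

end RealForms

section Contour

variable {E F : Type*} [NormedAddCommGroup E] [NormedSpace ℂ E]
  [NormedAddCommGroup F] [NormedSpace ℂ F]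

/-- The contour integral of `f` along `Γ`, that is, the integral of the form `f(z) dz`. -/
def contour (f : ℂ → E) : E := Γ.integral fun z => (ContinuousLinearMap.lsmul ℝ ℂ).flip (f z)

theorem contour_eq_sum (f : ℂ → E) :
    Γ.contour f = ∑ k, ∫ t in (0 : ℝ)..1, deriv (Γ.γ k) t • f (Γ.γ k t) := rfl

theorem contour_inv_sub {z : ℂ} (hz : z ∈ U) :
    Γ.contour (fun w => (w - z)⁻¹) = 2 * Real.pi * Complex.I := by
  have h := Γ.index_inside z hz
  simp only [contour_eq_sum, smul_eq_mul, mul_comm (deriv _ _)]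
  rw [inv_mul_eq_iff_eq_mul₀ Complex.two_pi_I_ne_zero] at h
  rw [h, mul_one]

variable {Γ}

theorem continuousOn_flip_lsmul {f : ℂ → E} {s : Set ℂ} (hf : ContinuousOn f s) :
    ContinuousOn (fun z => (ContinuousLinearMap.lsmul ℝ ℂ).flip (f z) : ℂ → ℂ →L[ℝ] E) s :=
  (ContinuousLinearMap.lsmul ℝ ℂ).flip.continuous.comp_continuousOn hf

theorem contour_congr {f g : ℂ → E} (h : EqOn f g (frontier U)) : Γ.contour f = Γ.contour g :=
  integral_congr fun z hz => by simp only [h hz]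

theorem contour_sub {f g : ℂ → E} (hf : ContinuousOn f (frontier U))
    (hg : ContinuousOn g (frontier U)) :
    Γ.contour (fun z => f z - g z) = Γ.contour f - Γ.contour g := by
  simp only [contour, map_sub]
  exact integral_sub (continuousOn_flip_lsmul hf) (continuousOn_flip_lsmul hg)

variable (Γ) in
theorem differentiableAt_contour_inv_sub_smul {f : ℂ → E} (hf : ContinuousOn f (frontier U))
    {z : ℂ} (hz : z ∉ frontier U) :
    DifferentiableAt ℂ (fun z => Γ.contour fun w => (w - z)⁻¹ • f w) z := by
  simp only [contour_eq_sum, smul_comm (deriv _ _)]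
  refine DifferentiableAt.fun_sum fun k _ => differentiableAt_integral_inv_sub_smul
    (Γ.continuousOn k) (intervalIntegrable (continuousOn_flip_lsmul hf) k) ?_
  rintro ⟨t, ht, rfl⟩
  exact hz (Γ.mem_frontier k ht)

variable [CompleteSpace E] [CompleteSpace F]

theorem contour_clm_apply (L : E →L[ℂ] F) {f : ℂ → E} (hf : ContinuousOn f (frontier U)) :
    Γ.contour (fun z => L (f z)) = L (Γ.contour f) := by
  refine Eq.trans (integral_congr fun z _ => ?_)
    (integral_clm_comp (L.restrictScalars ℝ) (continuousOn_flip_lsmul hf))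
  ext w
  exact (L.map_smul w (f z)).symm

theorem contour_smul (c : ℂ) {f : ℂ → E} (hf : ContinuousOn f (frontier U)) :
    Γ.contour (fun z => c • f z) = c • Γ.contour f :=
  contour_clm_apply (c • ContinuousLinearMap.id ℂ E) hf

theorem contour_smul_const {g : ℂ → ℂ} (hg : ContinuousOn g (frontier U)) (v : E) :
    Γ.contour (fun z => g z • v) = Γ.contour g • v :=
  contour_clm_apply (ContinuousLinearMap.toSpanSingleton ℂ v) hg

variable (Γ)

theorem contour_deriv_eq_zero {g : ℂ → E} (hg : Differentiable ℂ g) : Γ.contour (deriv g) = 0 := by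
  rw [← Γ.integral_fderiv_eq_zero ((hg.contDiff (n := 1)).restrict_scalars ℝ)]
  refine integral_congr fun z _ => ContinuousLinearMap.ext fun w => ?_
  rw [((hg z).hasDerivAt.hasFDerivAt.restrictScalars ℝ).fderiv]
  rfl

theorem contour_pow_eq_zero (n : ℕ) : Γ.contour (fun z => z ^ n) = 0 := by
  have hn : (n + 1 : ℂ) ≠ 0 := by exact_mod_cast n.succ_ne_zero
  have deriv_eq : deriv (fun z : ℂ => z ^ (n + 1) / (n + 1)) = fun z => z ^ n := by
    ext z
    simp [mul_div_cancel_left₀ _ hn]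
  rw [← deriv_eq]
  exact Γ.contour_deriv_eq_zero ((differentiable_pow (n + 1)).div_const _)

end Contour

end OrientedBoundary

/-! ## The Riesz–Dunford calculus -/

section RieszDunford

theorem differentiable_piecewise {𝕜 E F : Type*} [NontriviallyNormedField 𝕜]
    [NormedAddCommGroup E] [NormedSpace 𝕜 E] [NormedAddCommGroup F] [NormedSpace 𝕜 F]
    {s t : Set E} [∀ x, Decidable (x ∈ s)] {f g : E → F} (hs : IsOpen s) (ht : IsOpen t)
    (hst : s ∪ t = univ) (hf : DifferentiableOn 𝕜 f s) (hg : DifferentiableOn 𝕜 g t)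
    (hfg : EqOn f g (s ∩ t)) : Differentiable 𝕜 (s.piecewise f g) := by
  have eqOn_t : EqOn (s.piecewise f g) g t := fun x hx => by
    by_cases hxs : x ∈ s
    · rw [piecewise_eq_of_mem _ _ _ hxs, hfg ⟨hxs, hx⟩]
    · exact piecewise_eq_of_notMem _ _ _ hxs
  intro x
  rcases hst.symm ▸ mem_univ x with hx | hx
  · exact ((hf.congr (piecewise_eqOn s f g)).differentiableAt (hs.mem_nhds hx))
  · exact ((hg.congr eqOn_t).differentiableAt (ht.mem_nhds hx))

variable {A : Type*} [NormedRing A] [NormedAlgebra ℂ A] {a : A} {z w : ℂ}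

theorem resolvent_sub_resolvent (hz : z ∈ resolventSet ℂ a) (hw : w ∈ resolventSet ℂ a) :
    resolvent a z - resolvent a w = (w - z) • (resolvent a w * resolvent a z) := by
  have cancel_left : resolvent a w * (algebraMap ℂ A w - a) = 1 := Ring.inverse_mul_cancel _ hw
  have cancel_right : (algebraMap ℂ A z - a) * resolvent a z = 1 := Ring.mul_inverse_cancel _ hz
  calc resolvent a z - resolvent a w
      = resolvent a w * ((algebraMap ℂ A w - a) - (algebraMap ℂ A z - a)) * resolvent a z := by
        rw [mul_sub, cancel_left, sub_mul, one_mul, mul_assoc, cancel_right, mul_one]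
    _ = (w - z) • (resolvent a w * resolvent a z) := by
        rw [sub_sub_sub_cancel_right, ← map_sub, Algebra.algebraMap_eq_smul_one,
          mul_smul_comm, mul_one, smul_mul_assoc]

theorem pow_succ_smul_resolvent (hz : z ∈ resolventSet ℂ a) (n : ℕ) :
    z ^ (n + 1) • resolvent a z = a * (z ^ n • resolvent a z) + z ^ n • (1 : A) := by
  have smul_resolvent : z • resolvent a z = a * resolvent a z + 1 := by
    rw [← sub_eq_iff_eq_add', Algebra.smul_def, ← sub_mul]
    exact Ring.mul_inverse_cancel _ hz
  rw [pow_succ, mul_smul, smul_resolvent, smul_add, mul_smul_comm]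

theorem frontier_subset_resolventSet {U : Set ℂ} (hU : IsOpen U) (ha : spectrum ℂ a ⊆ U) :
    frontier U ⊆ resolventSet ℂ a := fun _ hz =>
  not_not.1 fun hza => (hU.frontier_eq ▸ hz).2 (ha hza)

variable [CompleteSpace A]

theorem eq_zero_of_differentiable_of_eq_mul_resolvent {F : ℂ → A} (hF : Differentiable ℂ F) {b : A}
    (h : ∀ z ∈ resolventSet ℂ a, F z = b * resolvent a z) : b = 0 := by
  have isUnit_resolvent := spectrum.eventually_isUnit_resolvent (𝕜 := ℂ) a
  have tendsto_zero : Tendsto F (cocompact ℂ) (𝓝 0) := by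
    rw [← cobounded_eq_cocompact]
    have hlim : Tendsto (fun z => b * resolvent a z) (Bornology.cobounded ℂ) (𝓝 0) := by
      simpa only [mul_zero] using (spectrum.resolvent_tendsto_cobounded (𝕜 := ℂ) a).const_mul b
    refine hlim.congr' ?_
    filter_upwards [isUnit_resolvent] with z hz
    exact (h z (spectrum.isUnit_resolvent.2 hz)).symm
  obtain ⟨z, hz⟩ := isUnit_resolvent.exists
  have F_eq_zero : F z = 0 := hF.apply_eq_of_tendsto_cocompact z tendsto_zero
  rw [h z (spectrum.isUnit_resolvent.2 hz)] at F_eq_zero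
  exact hz.mul_left_eq_zero.1 F_eq_zero

theorem differentiableOn_resolvent (a : A) :
    DifferentiableOn ℂ (resolvent a) (resolventSet ℂ a) := fun _ hz =>
  (spectrum.hasDerivAt_resolvent_const_left hz).differentiableAt.differentiableWithinAt

namespace OrientedBoundary

variable {U : Set ℂ} (Γ : OrientedBoundary U)

theorem contour_inv_sub_smul_resolvent (hU : IsOpen U) (ha : spectrum ℂ a ⊆ U) (hzU : z ∈ U)
    (hz : z ∈ resolventSet ℂ a) :
    Γ.contour (fun w => (w - z)⁻¹ • resolvent a w)
      = ((2 * Real.pi * Complex.I : ℂ) • 1 - Γ.contour (resolvent a)) * resolvent a z := by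
  have hfr := frontier_subset_resolventSet hU ha
  have hR : ContinuousOn (resolvent a) (frontier U) :=
    (differentiableOn_resolvent a).continuousOn.mono hfr
  have hne : ∀ w ∈ frontier U, w - z ≠ 0 := fun w hw h =>
    (hU.frontier_eq ▸ hw).2 (sub_eq_zero.1 h ▸ hzU)
  have hinv : ContinuousOn (fun w => (w - z)⁻¹) (frontier U) :=
    (continuousOn_id.sub continuousOn_const).inv₀ hne
  let mulRight : A →L[ℂ] A := (ContinuousLinearMap.mul ℂ A).flip (resolvent a z)
  calc Γ.contour (fun w => (w - z)⁻¹ • resolvent a w)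
      = Γ.contour (fun w => (w - z)⁻¹ • resolvent a z - mulRight (resolvent a w)) := by
        refine contour_congr fun w hw => eq_sub_of_add_eq' (add_eq_of_eq_sub ?_)
        rw [← smul_sub, resolvent_sub_resolvent hz (hfr hw), inv_smul_smul₀ (hne w hw)]
        rfl
    _ = Γ.contour (fun w => (w - z)⁻¹ • resolvent a z)
          - Γ.contour (fun w => mulRight (resolvent a w)) :=
        contour_sub (hinv.smul continuousOn_const) (mulRight.continuous.comp_continuousOn hR)
    _ = Γ.contour (fun w => (w - z)⁻¹) • resolvent a z - mulRight (Γ.contour (resolvent a)) := by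
        rw [contour_smul_const hinv, contour_clm_apply _ hR]
    _ = _ := by
        rw [Γ.contour_inv_sub hzU, sub_mul, smul_one_mul]
        rfl

theorem contour_resolvent (hU : IsOpen U) (ha : spectrum ℂ a ⊆ U) :
    Γ.contour (resolvent a) = (2 * Real.pi * Complex.I : ℂ) • 1 := by
  classical
  set b : A := (2 * Real.pi * Complex.I : ℂ) • 1 - Γ.contour (resolvent a)
  have hfr := frontier_subset_resolventSet hU ha
  have cover : U ∪ resolventSet ℂ a = univ := by
    rw [← compl_subset_iff_union]
    exact fun z hzU => not_not.1 fun hz => hzU (ha hz)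
  have eqOn_inter : EqOn (fun z => Γ.contour fun w => (w - z)⁻¹ • resolvent a w)
      (fun z => b * resolvent a z) (U ∩ resolventSet ℂ a) := fun z hz =>
    Γ.contour_inv_sub_smul_resolvent hU ha hz.1 hz.2
  have entire := differentiable_piecewise hU (spectrum.isOpen_resolventSet a) cover
    (fun z hz => (Γ.differentiableAt_contour_inv_sub_smul
      ((differentiableOn_resolvent a).continuousOn.mono hfr)
      fun hz' => (hU.frontier_eq ▸ hz').2 hz).differentiableWithinAt)
    ((differentiableOn_resolvent a).const_mul b) eqOn_inter
  refine (sub_eq_zero.1 (eq_zero_of_differentiable_of_eq_mul_resolvent (a := a) entire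
    fun z hz => ?_)).symm
  by_cases hzU : z ∈ U
  · exact (piecewise_eq_of_mem _ _ _ hzU).trans (eqOn_inter ⟨hzU, hz⟩)
  · exact piecewise_eq_of_notMem _ _ _ hzU

theorem contour_pow_smul_resolvent (hU : IsOpen U) (ha : spectrum ℂ a ⊆ U) (n : ℕ) :
    Γ.contour (fun z => z ^ n • resolvent a z) = (2 * Real.pi * Complex.I : ℂ) • a ^ n := by
  have hfr := frontier_subset_resolventSet hU ha
  have hR : ContinuousOn (resolvent a) (frontier U) :=
    (differentiableOn_resolvent a).continuousOn.mono hfr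
  induction n with
  | zero => simpa only [pow_zero, one_smul] using Γ.contour_resolvent hU ha
  | succ n ih =>
    have hpow : ContinuousOn (fun z : ℂ => z ^ n) (frontier U) := (continuous_pow n).continuousOn
    have hpowR : ContinuousOn (fun z => z ^ n • resolvent a z) (frontier U) := hpow.smul hR
    have contour_pow_one : Γ.contour (fun z => z ^ n • (1 : A)) = 0 := by
      rw [contour_smul_const hpow, Γ.contour_pow_eq_zero, zero_smul]
    calc Γ.contour (fun z => z ^ (n + 1) • resolvent a z)
        = Γ.contour (fun z => ContinuousLinearMap.mul ℂ A a (z ^ n • resolvent a z)) := by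
          rw [← sub_eq_zero, ← contour_pow_one, ← contour_sub]
          · exact contour_congr fun z hz => by
              simp [pow_succ_smul_resolvent (hfr hz)]
          · exact (continuous_pow _).continuousOn.smul hR
          · exact (ContinuousLinearMap.continuous _).comp_continuousOn hpowR
      _ = (2 * Real.pi * Complex.I : ℂ) • a ^ (n + 1) := by
          rw [contour_clm_apply _ hpowR, ih, ContinuousLinearMap.mul_apply',
            mul_smul_comm, pow_succ']

theorem contour_pow_smul_resolvent_apply {E : Type*} [NormedAddCommGroup E]
    [NormedSpace ℂ E] [CompleteSpace E] (hU : IsOpen U)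
    {a : E →L[ℂ] E} (ha : spectrum ℂ a ⊆ U) (n : ℕ) (v : E) :
    Γ.contour (fun z => z ^ n • resolvent a z v)
      = (2 * Real.pi * Complex.I : ℂ) • (a ^ n) v := by
  have continuousOn_resolvent : ContinuousOn (resolvent a) (frontier U) :=
    (differentiableOn_resolvent a).continuousOn.mono (frontier_subset_resolventSet hU ha)
  calc Γ.contour (fun z => z ^ n • resolvent a z v)
      = Γ.contour (fun z => z ^ n • resolvent a z) v :=
        contour_clm_apply (f := fun z => z ^ n • resolvent a z) (ContinuousLinearMap.apply ℂ E v)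
          ((continuous_pow n).continuousOn.smul continuousOn_resolvent)
    _ = (2 * Real.pi * Complex.I : ℂ) • (a ^ n) v := by
        rw [Γ.contour_pow_smul_resolvent hU ha n]
        rfl

end OrientedBoundary

end RieszDunford

/-! ## Complex structures on real normed spaces -/

section ComplexStructures

/-- A contractive action of the field of complex numbers on a real normed space `E`, extending
the real scalar multiplication. -/
structure ComplexStructure (E : Type*) [NormedAddCommGroup E] [NormedSpace ℝ E] where
  /-- the action of a complex number -/
  act : ℂ →ₐ[ℝ] Module.End ℝ E
  norm_act_le : ∀ z v, ‖act z v‖ ≤ ‖z‖ * ‖v‖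

namespace ComplexStructure

section Space

variable {E : Type*} [NormedAddCommGroup E] [NormedSpace ℝ E] (J : ComplexStructure E)

/-- The space `E` with the complex scalar multiplication given by `J`. -/
def Space (_J : ComplexStructure E) : Type _ := E

instance : NormedAddCommGroup J.Space := inferInstanceAs (NormedAddCommGroup E)

instance [CompleteSpace E] : CompleteSpace J.Space := inferInstanceAs (CompleteSpace E)

instance : Module ℂ J.Space := Module.compHom E J.act.toRingHom

instance : NormedSpace ℂ J.Space where
  norm_smul_le := J.norm_act_le

/-- The identity from `E` to the complex space `J.Space`. -/
def of : E ≃ₗᵢ[ℝ] J.Space where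
  __ := AddEquiv.refl E
  map_smul' r v := (LinearMap.congr_fun (J.act.commutes r) v).symm
  norm_map' _ := rfl

theorem smul_of (z : ℂ) (v : E) : z • J.of v = J.of (J.act z v) := rfl

end Space

section Algebra

variable {A : Type*} [NormedRing A] [NormedAlgebra ℝ A] (φ : ℂ →ₐ[ℝ] A)
  (hφ : ∀ z, ‖φ z‖ ≤ ‖z‖)

/-- The complex structure on a real normed algebra in which `z` acts by left multiplication
by `φ z`. -/
def ofLeftMul : ComplexStructure A where
  act := (Algebra.lmul ℝ A).comp φ
  norm_act_le z a := (norm_mul_le _ _).trans (by gcongr; exact hφ z)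

/-- The complex structure on a real normed algebra in which `z` acts by right multiplication
by `φ z`. -/
def ofRightMul : ComplexStructure A where
  act := (Algebra.lsmul ℝ ℝ A).comp (φ.toOpposite fun z w => by
    rw [Commute, SemiconjBy, ← map_mul, mul_comm, map_mul])
  norm_act_le z a := (norm_mul_le _ _).trans (by rw [mul_comm]; gcongr; exact hφ z)

/-- Left multiplication by `a`, which is complex linear for the complex structure
`ofRightMul φ hφ`. -/
def leftMul : A →ₐ[ℝ] ((ofRightMul φ hφ).Space →L[ℂ] (ofRightMul φ hφ).Space) :=
  AlgHom.ofLinearMap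
    { toFun := fun a => LinearMap.mkContinuous
        { toFun := fun b => (ofRightMul φ hφ).of (a * (ofRightMul φ hφ).of.symm b)
          map_add' := fun b c => by rw [map_add, mul_add, map_add]
          map_smul' := fun z b => (mul_assoc a ((ofRightMul φ hφ).of.symm b) (φ z)).symm } ‖a‖
        fun b => norm_mul_le a ((ofRightMul φ hφ).of.symm b)
      map_add' := fun a b => by ext c; exact add_mul a b _
      map_smul' := fun r a => by
        ext c
        exact (congrArg (ofRightMul φ hφ).of (smul_mul_assoc r a _)).trans (map_smul _ r _) }
    (by ext c : 1; exact one_mul (M := A) c) fun a b => by ext c; exact mul_assoc a b _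

theorem leftMul_apply_of (a b : A) :
    leftMul φ hφ a ((ofRightMul φ hφ).of b) = (ofRightMul φ hφ).of (a * b) := rfl

end Algebra

end ComplexStructure

section Quadratic

variable {B : Type*} [Ring B] [Algebra ℂ B] {b : B} {z : ℂ}

theorem commute_algebraMap_sub (b : B) (z w : ℂ) :
    Commute (algebraMap ℂ B z - b) (algebraMap ℂ B w - b) :=
  (Algebra.commute_algebraMap_left _ _).sub_left
    ((Algebra.commute_algebraMap_right _ _).sub_right (Commute.refl _))

theorem algebraMap_sub_mul_algebraMap_conj_sub (b : B) (z : ℂ) :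
    (algebraMap ℂ B z - b) * (algebraMap ℂ B (starRingEnd ℂ z) - b)
      = b ^ 2 - (2 * z.re) • b + (‖z‖ ^ 2) • (1 : B) := by
  have re_smul : (2 * z.re) • b = algebraMap ℂ B z * b + algebraMap ℂ B (starRingEnd ℂ z) * b := by
    rw [← Complex.coe_smul, Algebra.smul_def, ← add_mul, ← map_add, Complex.add_conj]
  have normSq_smul : (‖z‖ ^ 2) • (1 : B) = algebraMap ℂ B z * algebraMap ℂ B (starRingEnd ℂ z) := by
    rw [← Complex.coe_smul, Algebra.smul_def, mul_one, ← map_mul, Complex.mul_conj,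
      Complex.normSq_eq_norm_sq]
  rw [re_smul, normSq_smul, sub_mul, mul_sub, mul_sub, ← Algebra.commutes (starRingEnd ℂ z) b]
  noncomm_ring

theorem mem_resolventSet_of_isUnit_quadratic
    (h : IsUnit (b ^ 2 - (2 * z.re) • b + (‖z‖ ^ 2) • (1 : B))) : z ∈ resolventSet ℂ b := by
  rw [← algebraMap_sub_mul_algebraMap_conj_sub] at h
  exact ((commute_algebraMap_sub b z _).isUnit_mul_iff.1 h).1

theorem quadratic_mul_resolvent (hz : z ∈ resolventSet ℂ b) :
    (b ^ 2 - (2 * z.re) • b + (‖z‖ ^ 2) • (1 : B)) * resolvent b z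
      = algebraMap ℂ B (starRingEnd ℂ z) - b := by
  rw [← algebraMap_sub_mul_algebraMap_conj_sub, (commute_algebraMap_sub b z _).eq, mul_assoc,
    resolvent, Ring.mul_inverse_cancel _ hz, mul_one]

end Quadratic

namespace ComplexStructure

variable {A : Type*} [NormedRing A] [NormedAlgebra ℝ A] (φ : ℂ →ₐ[ℝ] A)
  (hφ : ∀ z, ‖φ z‖ ≤ ‖z‖) {a : A} {z : ℂ}

theorem leftMul_quadratic (a : A) (z : ℂ) :
    leftMul φ hφ (a ^ 2 - (2 * z.re) • a + (‖z‖ ^ 2) • 1)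
      = leftMul φ hφ a ^ 2 - (2 * z.re) • leftMul φ hφ a + (‖z‖ ^ 2) • 1 := by
  simp only [map_add, map_sub, map_smul, map_pow, map_one]

theorem mem_resolventSet_leftMul (h : IsUnit (a ^ 2 - (2 * z.re) • a + (‖z‖ ^ 2) • 1)) :
    z ∈ resolventSet ℂ (leftMul φ hφ a) :=
  mem_resolventSet_of_isUnit_quadratic (leftMul_quadratic φ hφ a z ▸ h.map (leftMul φ hφ))

theorem resolvent_leftMul_of_one (h : IsUnit (a ^ 2 - (2 * z.re) • a + (‖z‖ ^ 2) • 1)) :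
    resolvent (leftMul φ hφ a) z ((ofRightMul φ hφ).of 1) = (ofRightMul φ hφ).of
      (Ring.inverse (a ^ 2 - (2 * z.re) • a + (‖z‖ ^ 2) • 1) * (φ (starRingEnd ℂ z) - a)) := by
  set Q := a ^ 2 - (2 * z.re) • a + (‖z‖ ^ 2) • 1 with hQ
  set R := resolvent (leftMul φ hφ a) z
  have Q_mul_R : leftMul φ hφ Q * R
      = algebraMap ℂ _ (starRingEnd ℂ z) - leftMul φ hφ a := by
    rw [hQ, leftMul_quadratic]
    exact quadratic_mul_resolvent (mem_resolventSet_leftMul φ hφ h)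
  calc R ((ofRightMul φ hφ).of 1)
      = leftMul φ hφ (Ring.inverse Q) ((leftMul φ hφ Q * R) ((ofRightMul φ hφ).of 1)) := by
        rw [← mul_apply_eq_comp, ← mul_assoc, ← map_mul, Ring.inverse_mul_cancel Q h,
          map_one (leftMul φ hφ), one_mul]
    _ = leftMul φ hφ (Ring.inverse Q) ((ofRightMul φ hφ).of (1 * φ (starRingEnd ℂ z) - a * 1)) := by
        rw [Q_mul_R]
        rfl
    _ = (ofRightMul φ hφ).of (Ring.inverse Q * (φ (starRingEnd ℂ z) - a)) := by
        rw [leftMul_apply_of, one_mul, mul_one]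

theorem leftMul_pow_of_one (a : A) (n : ℕ) :
    (leftMul φ hφ a ^ n) ((ofRightMul φ hφ).of 1) = (ofRightMul φ hφ).of (a ^ n) := by
  rw [← map_pow, leftMul_apply_of, mul_one]

theorem contour_pow_smul_resolvent_leftMul_of_one [CompleteSpace A] {U : Set ℂ}
    (Γ : OrientedBoundary U) (hU : IsOpen U) (ha : spectrum ℂ (leftMul φ hφ a) ⊆ U) (n : ℕ) :
    Γ.contour (fun z => z ^ n • resolvent (leftMul φ hφ a) z ((ofRightMul φ hφ).of 1))
      = (2 * Real.pi * Complex.I : ℂ) • (ofRightMul φ hφ).of (a ^ n) := by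
  rw [Γ.contour_pow_smul_resolvent_apply hU ha, leftMul_pow_of_one]

end ComplexStructure

end ComplexStructures

/-! ## Slices -/

theorem imagUnits_mul_self {I : ℍ[ℝ]} (hI : I ∈ imagUnits) : I * I = -1 := by
  have normSq_eq := Quaternion.self_mul_star I
  rw [Quaternion.star_eq_neg.2 hI.1, mul_neg, Quaternion.normSq_eq_norm_mul_self, hI.2, mul_one,
    Quaternion.coe_one] at normSq_eq
  exact neg_eq_iff_eq_neg.1 normSq_eq

theorem slice_ofReal (I : ℍ[ℝ]) (x : ℝ) : slice I (x : ℂ) = (x : ℍ[ℝ]) := by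
  simp [slice]

/-- The identification `slice I` of the complex plane with `L_I`, as a homomorphism of real
algebras. -/
def sliceHom (I : imagUnits) : ℂ →ₐ[ℝ] ℍ[ℝ] where
  __ := (Complex.liftAux (I : ℍ[ℝ]) (imagUnits_mul_self I.2) : ℂ →+* ℍ[ℝ]).copy (slice I) <| by
    ext1 z
    rw [slice, Quaternion.mul_coe_eq_smul]
    exact (Complex.liftAux_apply _ (imagUnits_mul_self I.2) z).symm
  commutes' := slice_ofReal I

theorem sliceHom_apply (I : imagUnits) (z : ℂ) : sliceHom I z = slice I z := rfl

theorem slice_I (I : ℍ[ℝ]) : slice I Complex.I = I := by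
  simp [slice]

theorem star_slice (I : imagUnits) (z : ℂ) : star (slice I z) = slice I (starRingEnd ℂ z) := by
  have star_I : star (I : ℍ[ℝ]) = -I := Quaternion.star_eq_neg.2 I.2.1
  simp only [slice, star_add, star_mul, Quaternion.star_coe, star_I, Complex.conj_re,
    Complex.conj_im, Quaternion.coe_neg, mul_neg]
  rw [Quaternion.coe_commutes]

theorem norm_slice (I : imagUnits) (z : ℂ) : ‖slice I z‖ = ‖z‖ := by
  have h := Quaternion.self_mul_star (slice (I : ℍ[ℝ]) z)
  rw [star_slice, ← sliceHom_apply, ← sliceHom_apply, ← map_mul, Complex.mul_conj,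
    sliceHom_apply, slice_ofReal, sliceHom_apply, Quaternion.normSq_eq_norm_mul_self,
    Quaternion.coe_inj, Complex.normSq_eq_norm_sq, sq] at h
  exact ((mul_self_inj (norm_nonneg _) (norm_nonneg _)).1 h).symm

theorem re_slice (I : imagUnits) (z : ℂ) : (slice I z).re = z.re := by
  have re_I : (I : ℍ[ℝ]).re = 0 := I.2.1
  simp [slice, Quaternion.re_mul, re_I]

theorem slice_mem_ball_iff {I : imagUnits} {z : ℂ} {R : ℝ} :
    slice I z ∈ ball (0 : ℍ[ℝ]) R ↔ z ∈ ball (0 : ℂ) R := by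
  rw [mem_ball_zero_iff, mem_ball_zero_iff, norm_slice]

/-- The identification `slice I` of the complex plane with `L_I`, as a real linear isometry. -/
def sliceIsometry (I : imagUnits) : ℂ →ₗᵢ[ℝ] ℍ[ℝ] where
  __ := (sliceHom I).toLinearMap
  norm_map' := norm_slice I

theorem continuous_slice (I : imagUnits) : Continuous (slice I) := (sliceIsometry I).continuous

/-! ## Power series of regular functions -/

/-- The quaternions as a complex vector space on which `x + i y` acts by left multiplication
by `x + I y`. -/
abbrev sliceStructure (I : imagUnits) : ComplexStructure ℍ[ℝ] :=
  .ofLeftMul (sliceHom I) fun z => (norm_slice I z).le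

theorem sliceStructure_smul_of (I : imagUnits) (z : ℂ) (q : ℍ[ℝ]) :
    z • (sliceStructure I).of q = (sliceStructure I).of (slice I z * q) := rfl

theorem hasDerivAt_complex_mk_left (x y : ℝ) : HasDerivAt (fun x' : ℝ => (⟨x', y⟩ : ℂ)) 1 x := by
  simpa [Complex.mk_eq_add_mul_I] using
    (Complex.ofRealCLM.hasDerivAt (x := x)).add_const (y * Complex.I)

theorem hasDerivAt_complex_mk_right (x y : ℝ) :
    HasDerivAt (fun y' : ℝ => (⟨x, y'⟩ : ℂ)) Complex.I y := by
  simpa [Complex.mk_eq_add_mul_I] using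
    ((Complex.ofRealCLM.hasDerivAt (x := y)).mul_const Complex.I).const_add (x : ℂ)

theorem IsLeftRegularOn.cauchyRiemann {f : ℍ[ℝ] → ℍ[ℝ]} {B : Set ℍ[ℝ]}
    (hf : IsLeftRegularOn f B) {I : imagUnits} {z : ℂ} (hz : slice I z ∈ B) {D : ℂ →L[ℝ] ℍ[ℝ]}
    (hD : HasFDerivAt (fun w => f (slice I w)) D z) :
    D Complex.I = (I : ℍ[ℝ]) * D 1 := by
  have deriv_x : HasDerivAt (fun x : ℝ => f (slice I ⟨x, z.im⟩)) (D 1) z.re :=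
    HasFDerivAt.comp_hasDerivAt z.re (l := fun w => f (slice I w)) hD
      (hasDerivAt_complex_mk_left z.re z.im)
  have deriv_y : HasDerivAt (fun y : ℝ => f (slice I ⟨z.re, y⟩)) (D Complex.I) z.im :=
    HasFDerivAt.comp_hasDerivAt z.im (l := fun w => f (slice I w)) hD
      (hasDerivAt_complex_mk_right z.re z.im)
  have regular := hf.2 I I.2 z.re z.im hz
  rw [deriv_x.deriv, deriv_y.deriv] at regular
  have sum_eq_zero := (smul_eq_zero.1 regular).resolve_left (by norm_num)
  rw [eq_neg_of_add_eq_zero_left sum_eq_zero, mul_neg, ← mul_assoc, imagUnits_mul_self I.2]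
  simp

theorem eq_of_hasSum_pow_smul {E : Type*} [NormedAddCommGroup E] [NormedSpace ℝ E] {r : ℝ}
    (hr : 0 < r) {a b : ℕ → E} {g : ℝ → E}
    (ha : ∀ x ∈ ball (0 : ℝ) r, HasSum (fun n => x ^ n • a n) (g x))
    (hb : ∀ x ∈ ball (0 : ℝ) r, HasSum (fun n => x ^ n • b n) (g x)) : a = b := by
  let p (c : ℕ → E) : FormalMultilinearSeries ℝ ℝ E := fun n =>
    ContinuousMultilinearMap.mkPiRing ℝ (Fin n) (c n)
  have coeff_p (c : ℕ → E) (n : ℕ) : (p c).coeff n = c n := by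
    simp [p, FormalMultilinearSeries.coeff]
  have hasFPowerSeriesAt (c : ℕ → E)
      (hc : ∀ x ∈ ball (0 : ℝ) r, HasSum (fun n => x ^ n • c n) (g x)) :
      HasFPowerSeriesAt g (p c) 0 := by
    rw [hasFPowerSeriesAt_iff]
    filter_upwards [ball_mem_nhds (0 : ℝ) hr] with x hx
    simpa only [coeff_p, zero_add] using hc x hx
  funext n
  rw [← coeff_p a n,
    (hasFPowerSeriesAt a ha).eq_formalMultilinearSeries (hasFPowerSeriesAt b hb), coeff_p]

section LeftRegular

variable {f : ℍ[ℝ] → ℍ[ℝ]} {R : ℝ}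

theorem IsLeftRegularOn.differentiableOn_of_slice (hf : IsLeftRegularOn f (ball 0 R))
    (I : imagUnits) :
    DifferentiableOn ℂ (fun z => (sliceStructure I).of (f (slice I z))) (ball 0 R) := by
  intro z hz
  have hz' : slice I z ∈ ball (0 : ℍ[ℝ]) R := slice_mem_ball_iff.2 hz
  obtain ⟨D, hD⟩ : DifferentiableAt ℝ (fun w => f (slice I w)) z :=
    (hf.1.differentiableAt (isOpen_ball.mem_nhds hz')).comp z
      (sliceIsometry I).toContinuousLinearMap.differentiableAt
  have hD' : HasFDerivAt (fun w => (sliceStructure I).of (f (slice I w)))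
      (((sliceStructure I).of : ℍ[ℝ] →L[ℝ] (sliceStructure I).Space) ∘L D) z :=
    ((sliceStructure I).of : ℍ[ℝ] →L[ℝ] (sliceStructure I).Space).hasFDerivAt.comp z hD
  refine (hD'.hasFDerivWithinAt.complexOfReal ?_).differentiableWithinAt
  change (sliceStructure I).of (D Complex.I) = Complex.I • (sliceStructure I).of (D 1)
  rw [sliceStructure_smul_of, slice_I, hf.cauchyRiemann hz' hD]

theorem IsLeftRegularOn.exists_hasSum_slice (hf : IsLeftRegularOn f (ball 0 R)) (I : imagUnits) :
    ∃ a : ℕ → ℍ[ℝ], ∀ z ∈ ball (0 : ℂ) R,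
      HasSum (fun n => slice I z ^ n * a n) (f (slice I z)) := by
  set F := fun z => (sliceStructure I).of (f (slice I z))
  refine ⟨fun n => (sliceStructure I).of.symm ((n.factorial : ℂ)⁻¹ • iteratedDeriv n F 0),
    fun z hz => ?_⟩
  have taylor := (Complex.hasSum_taylorSeries_on_ball (hf.differentiableOn_of_slice I) hz).mapL
    ((sliceStructure I).of.symm : (sliceStructure I).Space →L[ℝ] ℍ[ℝ])
  refine taylor.congr_fun fun n => ?_
  rw [smul_comm, sub_zero, ← sliceHom_apply, ← map_pow]
  rfl

theorem IsLeftRegularOn.exists_hasSum (hf : IsLeftRegularOn f (ball 0 R)) (hR : 0 < R) :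
    ∃ a : ℕ → ℍ[ℝ], ∀ (I : imagUnits), ∀ z ∈ ball (0 : ℂ) R,
      HasSum (fun n => slice I z ^ n * a n) (f (slice I z)) := by
  choose a ha using fun I : imagUnits => hf.exists_hasSum_slice I
  have hasSum_real (I : imagUnits) (x : ℝ) (hx : x ∈ ball (0 : ℝ) R) :
      HasSum (fun n => x ^ n • a I n) (f x) := by
    have h := ha I x (by simpa using hx)
    simpa only [slice_ofReal, ← Quaternion.coe_pow, Quaternion.coe_mul_eq_smul] using h
  rcases isEmpty_or_nonempty imagUnits with _ | ⟨⟨J⟩⟩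
  · exact ⟨0, isEmptyElim⟩
  · exact ⟨a J, fun I z hz =>
      eq_of_hasSum_pow_smul hR (hasSum_real I) (hasSum_real J) ▸ ha I z hz⟩

end LeftRegular

/-! ## The `S`-resolvent as a resolvent -/

section Quadratic

variable {V : Type*} [NormedAddCommGroup V] [NormedSpace ℝ V] [Module ℍ[ℝ]ᵐᵒᵖ V]
  [IsScalarTower ℝ ℍ[ℝ]ᵐᵒᵖ V] {T : V →L[ℍ[ℝ]ᵐᵒᵖ] V} {I : imagUnits} {z : ℂ}

theorem quadOp_slice (T : V →L[ℍ[ℝ]ᵐᵒᵖ] V) (I : imagUnits) (z : ℂ) :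
    quadOp T (slice I z) = T ^ 2 - (2 * z.re) • T + (‖z‖ ^ 2) • 1 := by
  rw [quadOp, re_slice, norm_slice]

theorem isUnit_quadratic_of_slice_notMem_sSpectrum (hz : slice I z ∉ sSpectrum T) :
    IsUnit (T ^ 2 - (2 * z.re) • T + (‖z‖ ^ 2) • 1) :=
  quadOp_slice T I z ▸ not_not.1 hz

end Quadratic

section Operators

variable {V : Type*} [NormedAddCommGroup V] [NormedSpace ℝ V]
  [Module ℍ[ℝ] V] [Module ℍ[ℝ]ᵐᵒᵖ V]
  [IsScalarTower ℝ ℍ[ℝ] V] [IsScalarTower ℝ ℍ[ℝ]ᵐᵒᵖ V]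
  [SMulCommClass ℍ[ℝ]ᵐᵒᵖ ℍ[ℝ] V]
  [NormSMulClass ℍ[ℝ] V] [NormSMulClass ℍ[ℝ]ᵐᵒᵖ V]

instance : NormedAlgebra ℝ (V →L[ℍ[ℝ]ᵐᵒᵖ] V) where
  norm_smul_le := norm_smul_le

/-- The map `a ↦ a 𝓘` as a homomorphism of real algebras. -/
def scalarOpHom : ℍ[ℝ] →ₐ[ℝ] (V →L[ℍ[ℝ]ᵐᵒᵖ] V) where
  toFun := scalarOp
  map_one' := ContinuousLinearMap.ext (one_smul ℍ[ℝ])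
  map_mul' a b := ContinuousLinearMap.ext (mul_smul a b)
  map_zero' := ContinuousLinearMap.ext (zero_smul ℍ[ℝ])
  map_add' a b := ContinuousLinearMap.ext (add_smul a b)
  commutes' r := ContinuousLinearMap.ext (algebraMap_smul ℍ[ℝ] r)

theorem norm_scalarOp_le (a : ℍ[ℝ]) : ‖(scalarOp a : V →L[ℍ[ℝ]ᵐᵒᵖ] V)‖ ≤ ‖a‖ := by
  rw [norm_eq]
  exact ContinuousLinearMap.opNorm_le_bound _ (norm_nonneg a) fun v => (norm_smul a v).le

/-- The map `a ↦ a 𝓘` as a bounded real linear map. -/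
def scalarOpL : ℍ[ℝ] →L[ℝ] (V →L[ℍ[ℝ]ᵐᵒᵖ] V) :=
  scalarOpHom.toLinearMap.mkContinuous 1 fun a => (one_mul ‖a‖).symm ▸ norm_scalarOp_le a

variable (V) in
/-- The map `x + i y ↦ (x + I y) 𝓘` as a homomorphism of real algebras. -/
def sliceOpHom (I : imagUnits) : ℂ →ₐ[ℝ] (V →L[ℍ[ℝ]ᵐᵒᵖ] V) :=
  scalarOpHom.comp (sliceHom I)

variable (V) in
theorem norm_sliceOpHom_le (I : imagUnits) (z : ℂ) : ‖sliceOpHom V I z‖ ≤ ‖z‖ :=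
  (norm_scalarOp_le _).trans (norm_slice I z).le

variable (V) in
/-- The bounded right linear operators on `V` as a complex vector space on which `x + i y` acts by
`A ↦ A ((x + I y) 𝓘)`. -/
abbrev operatorStructure (I : imagUnits) : ComplexStructure (V →L[ℍ[ℝ]ᵐᵒᵖ] V) :=
  .ofRightMul (sliceOpHom V I) (norm_sliceOpHom_le V I)

/-- The operator `A ↦ T A`, which is complex linear on `operatorStructure V I`. -/
abbrev leftComp (I : imagUnits) (T : V →L[ℍ[ℝ]ᵐᵒᵖ] V) :
    (operatorStructure V I).Space →L[ℂ] (operatorStructure V I).Space :=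
  ComplexStructure.leftMul (sliceOpHom V I) (norm_sliceOpHom_le V I) T

variable {T : V →L[ℍ[ℝ]ᵐᵒᵖ] V} {I : imagUnits} {z : ℂ}

theorem mem_resolventSet_leftComp (hz : slice I z ∉ sSpectrum T) :
    z ∈ resolventSet ℂ (leftComp I T) :=
  ComplexStructure.mem_resolventSet_leftMul (sliceOpHom V I) (norm_sliceOpHom_le V I)
    (isUnit_quadratic_of_slice_notMem_sSpectrum hz)

theorem resolvent_leftComp_of_one (hz : slice I z ∉ sSpectrum T) :
    resolvent (leftComp I T) z ((operatorStructure V I).of 1)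
      = (operatorStructure V I).of (sResolvent (slice I z) T) := by
  refine (ComplexStructure.resolvent_leftMul_of_one (sliceOpHom V I) (norm_sliceOpHom_le V I)
    (isUnit_quadratic_of_slice_notMem_sSpectrum hz)).trans (congrArg _ ?_)
  rw [sResolvent, ← mul_neg, neg_sub, quadOp_slice, star_slice]
  rfl

end Operators

/-! ## The functional calculus of a power series -/

section CauchyIntegral

variable {V : Type*} [NormedAddCommGroup V] [NormedSpace ℝ V]
  [Module ℍ[ℝ] V] [Module ℍ[ℝ]ᵐᵒᵖ V]
  [IsScalarTower ℝ ℍ[ℝ] V] [IsScalarTower ℝ ℍ[ℝ]ᵐᵒᵖ V]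
  [SMulCommClass ℍ[ℝ]ᵐᵒᵖ ℍ[ℝ] V]
  [NormSMulClass ℍ[ℝ] V] [NormSMulClass ℍ[ℝ]ᵐᵒᵖ V]

/-- The form `S ds_I q`, linear in `q`, on the slice `L_I`. -/
def cauchyForm (I : imagUnits) (S : V →L[ℍ[ℝ]ᵐᵒᵖ] V) :
    ℍ[ℝ] →L[ℝ] ℂ →L[ℝ] (V →L[ℍ[ℝ]ᵐᵒᵖ] V) :=
  ContinuousLinearMap.compL ℝ ℂ ℍ[ℝ] (V →L[ℍ[ℝ]ᵐᵒᵖ] V)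
      (ContinuousLinearMap.mul ℝ (V →L[ℍ[ℝ]ᵐᵒᵖ] V) S ∘L scalarOpL)
    ∘L (ContinuousLinearMap.compL ℝ ℂ ℍ[ℝ] ℍ[ℝ]).flip
      (ContinuousLinearMap.mul ℝ ℍ[ℝ] (-I) ∘L (sliceIsometry I).toContinuousLinearMap)
    ∘L (ContinuousLinearMap.mul ℝ ℍ[ℝ]).flip

theorem cauchyForm_apply (I : imagUnits) (S : V →L[ℍ[ℝ]ᵐᵒᵖ] V) (q : ℍ[ℝ]) (w : ℂ) :
    cauchyForm I S q w = S * scalarOp (-I * slice I w * q) := rfl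

theorem norm_cauchyForm_le (I : imagUnits) (S : V →L[ℍ[ℝ]ᵐᵒᵖ] V) (q : ℍ[ℝ]) :
    ‖cauchyForm I S q‖ ≤ ‖S‖ * ‖q‖ := by
  refine ContinuousLinearMap.opNorm_le_bound _ (by positivity) fun w => ?_
  calc ‖S * scalarOp (-I * slice I w * q)‖
      ≤ ‖S‖ * ‖-(I : ℍ[ℝ]) * slice I w * q‖ :=
        (norm_mul_le _ _).trans (by gcongr; exact norm_scalarOp_le _)
    _ = ‖S‖ * ‖q‖ * ‖w‖ := by
        rw [norm_mul, norm_mul, norm_neg, I.2.2, norm_slice]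
        ring

theorem continuousOn_cauchyForm (I : imagUnits) {s : Set ℂ} {S : ℂ → V →L[ℍ[ℝ]ᵐᵒᵖ] V}
    {q : ℂ → ℍ[ℝ]} (hS : ContinuousOn S s) (hq : ContinuousOn q s) :
    ContinuousOn (fun z => cauchyForm I (S z) (q z)) s := by
  unfold cauchyForm
  fun_prop

theorem cauchyForm_mul (I : imagUnits) (S : V →L[ℍ[ℝ]ᵐᵒᵖ] V) (q a : ℍ[ℝ]) :
    cauchyForm I S (q * a)
      = (ContinuousLinearMap.mul ℝ (V →L[ℍ[ℝ]ᵐᵒᵖ] V)).flip (scalarOp a) ∘L cauchyForm I S q := by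
  ext1 w
  calc S * scalarOpHom (-(I : ℍ[ℝ]) * slice I w * (q * a))
      = S * scalarOpHom (-(I : ℍ[ℝ]) * slice I w * q) * scalarOpHom a := by
        rw [mul_assoc S, ← map_mul, mul_assoc _ q a]

/-- In the complex structure on the slice `L_I`, the form `ds_I = -I ds` becomes `-i dz`. -/
theorem of_comp_cauchyForm_slice (I : imagUnits) (S : V →L[ℍ[ℝ]ᵐᵒᵖ] V) (z : ℂ) :
    (operatorStructure V I).of.toContinuousLinearEquiv.toContinuousLinearMap
        ∘L cauchyForm I S (slice I z)
      = (ContinuousLinearMap.lsmul ℝ ℂ).flip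
          (-Complex.I • z • (operatorStructure V I).of S) := by
  ext1 w
  change (operatorStructure V I).of (cauchyForm I S (slice I z) w)
    = w • -Complex.I • z • (operatorStructure V I).of S
  rw [smul_smul, smul_smul, ComplexStructure.smul_of, cauchyForm_apply]
  change S * scalarOp _ = S * scalarOp (sliceHom I _)
  rw [mul_comm w, map_mul, map_mul, map_neg, sliceHom_apply, slice_I]
  rfl

end CauchyIntegral

section Admissible

variable {V : Type*} [NormedAddCommGroup V] [NormedSpace ℝ V] [Module ℍ[ℝ]ᵐᵒᵖ V]
  [IsScalarTower ℝ ℍ[ℝ]ᵐᵒᵖ V] {T : V →L[ℍ[ℝ]ᵐᵒᵖ] V} {R : ℝ} {I : imagUnits} {U : Set ℂ}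

namespace IsAdmissible

theorem slice_notMem_sSpectrum (hU : IsAdmissible T R I U) {z : ℂ} (hz : z ∈ frontier U) :
    slice I z ∉ sSpectrum T := fun h =>
  (hU.isOpen.frontier_eq ▸ hz).2 (hU.spectrum_subset z h)

theorem frontier_subset_ball (hU : IsAdmissible T R I U) : frontier U ⊆ ball 0 R := fun z hz =>
  slice_mem_ball_iff.1 (hU.closure_subset z (frontier_subset_closure hz))

theorem isCompact_frontier (hU : IsAdmissible T R I U) : IsCompact (frontier U) :=
  hU.isBounded.isCompact_closure.of_isClosed_subset isClosed_frontier frontier_subset_closure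

end IsAdmissible

end Admissible

section FunctionalCalculus

variable {V : Type*} [NormedAddCommGroup V] [NormedSpace ℝ V]
  [Module ℍ[ℝ] V] [Module ℍ[ℝ]ᵐᵒᵖ V]
  [IsScalarTower ℝ ℍ[ℝ] V] [IsScalarTower ℝ ℍ[ℝ]ᵐᵒᵖ V]
  [SMulCommClass ℍ[ℝ]ᵐᵒᵖ ℍ[ℝ] V]
  [NormSMulClass ℍ[ℝ] V] [NormSMulClass ℍ[ℝ]ᵐᵒᵖ V]
  {T : V →L[ℍ[ℝ]ᵐᵒᵖ] V} {R : ℝ} {I : imagUnits} {U : Set ℂ} {f : ℍ[ℝ] → ℍ[ℝ]}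

/-- The form `S⁻¹(s, T) ds_I f(s)` on the slice `L_I`. -/
def resolventForm (T : V →L[ℍ[ℝ]ᵐᵒᵖ] V) (I : imagUnits) (f : ℍ[ℝ] → ℍ[ℝ]) (z : ℂ) :
    ℂ →L[ℝ] (V →L[ℍ[ℝ]ᵐᵒᵖ] V) :=
  cauchyForm I (sResolvent (slice I z) T) (f (slice I z))

theorem cauchyIntegral_eq_integral_resolventForm (T : V →L[ℍ[ℝ]ᵐᵒᵖ] V) (f : ℍ[ℝ] → ℍ[ℝ])
    (I : imagUnits) (Γ : OrientedBoundary U) :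
    cauchyIntegral T f I Γ = (1 / (2 * Real.pi)) • Γ.integral (resolventForm T I f) := rfl

theorem of_comp_resolventForm_pow {z : ℂ} (hz : slice I z ∉ sSpectrum T) (n : ℕ) :
    (operatorStructure V I).of.toContinuousLinearEquiv.toContinuousLinearMap
        ∘L resolventForm T I (· ^ n) z
      = (ContinuousLinearMap.lsmul ℝ ℂ).flip
          (-Complex.I • z ^ n • resolvent (leftComp I T) z ((operatorStructure V I).of 1)) := by
  rw [resolvent_leftComp_of_one hz, ← of_comp_cauchyForm_slice, resolventForm,
    show slice I z ^ n = slice I (z ^ n) from (map_pow (sliceHom I) z n).symm]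

namespace IsAdmissible

theorem spectrum_leftComp_subset (hU : IsAdmissible T R I U) : spectrum ℂ (leftComp I T) ⊆ U :=
  fun z hz => hU.spectrum_subset z <| by_contra fun h => hz (mem_resolventSet_leftComp h)

variable [CompleteSpace V]

theorem continuousOn_resolvent_leftComp (hU : IsAdmissible T R I U) :
    ContinuousOn (resolvent (leftComp I T)) (frontier U) :=
  (differentiableOn_resolvent _).continuousOn.mono
    (frontier_subset_resolventSet hU.isOpen hU.spectrum_leftComp_subset)

theorem continuousOn_sResolvent (hU : IsAdmissible T R I U) :
    ContinuousOn (fun z => sResolvent (slice I z) T) (frontier U) := by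
  have h := (operatorStructure V I).of.symm.continuous.comp_continuousOn
    (hU.continuousOn_resolvent_leftComp.clm_apply
      (continuousOn_const (c := (operatorStructure V I).of 1)))
  exact h.congr fun z hz => congrArg (operatorStructure V I).of.symm
    (resolvent_leftComp_of_one (hU.slice_notMem_sSpectrum hz)).symm

theorem continuousOn_resolventForm (hU : IsAdmissible T R I U)
    (hf : ContinuousOn f (ball 0 R)) : ContinuousOn (resolventForm T I f) (frontier U) :=
  continuousOn_cauchyForm I hU.continuousOn_sResolvent
    (hf.comp (continuous_slice I).continuousOn fun _ hz =>
      hU.closure_subset _ (frontier_subset_closure hz))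

theorem intervalIntegrable_cauchyIntegrand (hU : IsAdmissible T R I U)
    (hf : ContinuousOn f (ball 0 R)) (Γ : OrientedBoundary U) (k : Fin Γ.n) :
    IntervalIntegrable (cauchyIntegrand T f I (Γ.γ k)) volume 0 1 :=
  OrientedBoundary.intervalIntegrable (hU.continuousOn_resolventForm hf) k

theorem integral_resolventForm_pow (hU : IsAdmissible T R I U) (Γ : OrientedBoundary U) (n : ℕ) :
    Γ.integral (resolventForm T I (· ^ n)) = (2 * Real.pi) • T ^ n := by
  set J := operatorStructure V I
  have continuousOn_resolvent : ContinuousOn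
      (fun z => z ^ n • resolvent (leftComp I T) z (J.of 1)) (frontier U) :=
    (continuous_pow n).continuousOn.smul (hU.continuousOn_resolvent_leftComp.clm_apply
      continuousOn_const)
  refine J.of.injective ?_
  calc J.of (Γ.integral (resolventForm T I (· ^ n)))
      = Γ.contour (fun z => -Complex.I • z ^ n • resolvent (leftComp I T) z (J.of 1)) :=
        (OrientedBoundary.integral_clm_comp J.of.toContinuousLinearEquiv.toContinuousLinearMap
          (hU.continuousOn_resolventForm (continuous_pow n).continuousOn)).symm.trans
          (OrientedBoundary.integral_congr fun z hz =>
            of_comp_resolventForm_pow (hU.slice_notMem_sSpectrum hz) n)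
    _ = -Complex.I • (2 * Real.pi * Complex.I : ℂ) • J.of (T ^ n) := by
        rw [OrientedBoundary.contour_smul _ continuousOn_resolvent]
        exact congrArg _ (ComplexStructure.contour_pow_smul_resolvent_leftMul_of_one _ _ Γ hU.isOpen
          hU.spectrum_leftComp_subset n)
    _ = ((2 * Real.pi : ℝ) : ℂ) • J.of (T ^ n) := by
        rw [smul_smul]
        congr 1
        push_cast
        linear_combination (-2 * Real.pi : ℂ) * Complex.I_mul_I
    _ = J.of ((2 * Real.pi) • T ^ n) := by
        rw [Complex.coe_smul, map_smul]

theorem integral_resolventForm_pow_mul (hU : IsAdmissible T R I U) (Γ : OrientedBoundary U)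
    (n : ℕ) (a : ℍ[ℝ]) :
    Γ.integral (resolventForm T I (· ^ n * a)) = (2 * Real.pi) • (T ^ n * scalarOp a) := by
  calc Γ.integral (resolventForm T I (· ^ n * a))
      = Γ.integral (fun z => (ContinuousLinearMap.mul ℝ (V →L[ℍ[ℝ]ᵐᵒᵖ] V)).flip (scalarOp a)
          ∘L resolventForm T I (· ^ n) z) :=
        OrientedBoundary.integral_congr fun z _ => cauchyForm_mul I _ _ a
    _ = Γ.integral (resolventForm T I (· ^ n)) * scalarOp a :=
        OrientedBoundary.integral_clm_comp _
          (hU.continuousOn_resolventForm (continuous_pow n).continuousOn)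
    _ = (2 * Real.pi) • (T ^ n * scalarOp a) := by
        rw [hU.integral_resolventForm_pow, smul_mul_assoc]

theorem hasSum_integral_resolventForm (hU : IsAdmissible T R I U) (Γ : OrientedBoundary U)
    (hR : 0 < R) {a : ℕ → ℍ[ℝ]}
    (ha : ∀ z ∈ ball (0 : ℂ) R, HasSum (fun n => slice I z ^ n * a n) (f (slice I z))) :
    HasSum (fun n => Γ.integral (resolventForm T I (· ^ n * a n)))
      (Γ.integral (resolventForm T I f)) := by
  obtain ⟨r, ⟨hr, hrR⟩, frontier_subset⟩ :=
    exists_pos_lt_subset_ball hR isClosed_frontier hU.frontier_subset_ball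
  obtain ⟨C, hC⟩ := hU.isCompact_frontier.exists_bound_of_continuousOn hU.continuousOn_sResolvent
  have norm_slice_r : ‖slice I (r : ℂ)‖ = r := by
    rw [norm_slice, Complex.norm_real, Real.norm_of_nonneg hr.le]
  have summable_norm : Summable fun n => r ^ n * ‖a n‖ := by
    simpa only [norm_mul, norm_pow, norm_slice_r]
      using (ha r (by rwa [← slice_mem_ball_iff, mem_ball_zero_iff, norm_slice_r])).summable.norm
  refine Γ.hasSum_integral (u := fun n => C * (r ^ n * ‖a n‖))
    (fun n => hU.continuousOn_resolventForm (by fun_prop)) (summable_norm.mul_left C)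
    (fun n z hz => ?_)
    (fun z hz => (cauchyForm I (sResolvent (slice I z) T)).hasSum
      (ha z (hU.frontier_subset_ball hz)))
  have C_nonneg : 0 ≤ C := (norm_nonneg _).trans (hC z hz)
  calc ‖resolventForm T I (· ^ n * a n) z‖
      ≤ ‖sResolvent (slice I z) T‖ * ‖slice I z ^ n * a n‖ := norm_cauchyForm_le _ _ _
    _ ≤ C * (r ^ n * ‖a n‖) := by
        rw [norm_mul, norm_pow, norm_slice]
        gcongr
        · exact hC z hz
        · exact (mem_ball_zero_iff.1 (frontier_subset hz)).le

theorem hasSum_cauchyIntegral (hU : IsAdmissible T R I U) (Γ : OrientedBoundary U)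
    (hR : 0 < R) {a : ℕ → ℍ[ℝ]}
    (ha : ∀ z ∈ ball (0 : ℂ) R, HasSum (fun n => slice I z ^ n * a n) (f (slice I z))) :
    HasSum (fun n => T ^ n * scalarOp (a n)) (cauchyIntegral T f I Γ) := by
  have h := (hU.hasSum_integral_resolventForm Γ hR ha).const_smul (1 / (2 * Real.pi))
  rw [cauchyIntegral_eq_integral_resolventForm]
  simpa only [hU.integral_resolventForm_pow_mul, smul_smul, one_div_mul_cancel
    Real.two_pi_pos.ne', one_smul] using h

end IsAdmissible

end FunctionalCalculus

/-! ## Discs -/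

section Disc

variable {r : ℝ}

/-- The circle of radius `r` about the origin, parametrized by `[0, 1]`. -/
def circleCurve (r t : ℝ) : ℂ := circleMap 0 r (2 * Real.pi * t)

theorem hasDerivAt_circleCurve (r t : ℝ) : HasDerivAt (circleCurve r)
    ((2 * Real.pi) • deriv (circleMap 0 r) (2 * Real.pi * t)) t := by
  have h := (hasDerivAt_circleMap (0 : ℂ) r (2 * Real.pi * t)).scomp t
    ((hasDerivAt_id t).const_mul (2 * Real.pi))
  rwa [mul_one, ← deriv_circleMap] at h

theorem integral_circleCurve (g : ℂ → ℂ) (r : ℝ) :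
    ∫ t in (0 : ℝ)..1, g (circleCurve r t) * deriv (circleCurve r) t
      = ∮ z in C(0, r), g z := by
  have h := intervalIntegral.smul_integral_comp_mul_left (a := 0) (b := 1)
    (fun θ => deriv (circleMap 0 r) θ • g (circleMap 0 r θ)) (2 * Real.pi)
  rw [mul_zero, mul_one, ← intervalIntegral.integral_smul] at h
  rw [circleIntegral, ← h]
  refine intervalIntegral.integral_congr fun t _ => ?_
  simp only [(hasDerivAt_circleCurve r t).deriv, circleCurve, smul_eq_mul,
    Complex.real_smul]
  ring

theorem lipschitzWith_circleCurve (r : ℝ) :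
    ∃ K, LipschitzWith K (circleCurve r) :=
  ⟨_, (lipschitzWith_circleMap 0 r).comp (lipschitzWith_smul (2 * Real.pi))⟩

theorem image_circleCurve (hr : 0 ≤ r) :
    circleCurve r '' Icc 0 1 = sphere 0 r := by
  refine Subset.antisymm (image_subset_iff.2 fun t _ => circleMap_mem_sphere _ hr _) ?_
  rw [← abs_of_nonneg hr, ← image_circleMap_Ioc, abs_of_nonneg hr]
  rintro _ ⟨θ, hθ, rfl⟩
  refine ⟨θ / (2 * Real.pi), ⟨div_nonneg hθ.1.le Real.two_pi_pos.le,
    (div_le_one Real.two_pi_pos).2 hθ.2⟩, ?_⟩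
  rw [circleCurve, mul_div_cancel₀ _ Real.two_pi_pos.ne']

theorem circleIntegral_inv_sub_eq_zero (hr : 0 ≤ r) {c a : ℂ} (ha : a ∉ closedBall c r) :
    ∮ z in C(c, r), (z - a)⁻¹ = 0 := by
  have sub_ne_zero : ∀ z ∈ closedBall c r, z - a ≠ 0 := fun z hz h => ha (sub_eq_zero.1 h ▸ hz)
  exact Complex.circleIntegral_eq_zero_of_differentiable_on_off_countable hr countable_empty
    (ContinuousOn.inv₀ (continuousOn_id.sub continuousOn_const) sub_ne_zero)
    fun z hz => (differentiableAt_id.sub_const a).inv (sub_ne_zero z (ball_subset_closedBall hz.1))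

/-- The circle of radius `r` as the oriented boundary of a disc. -/
def circleBoundary (hr : 0 < r) : OrientedBoundary (ball (0 : ℂ) r) where
  n := 1
  γ _ := circleCurve r
  lipschitz _ := (lipschitzWith_circleCurve r).imp fun _ h => h.lipschitzOnWith
  closed _ := by simp [circleCurve, circleMap]
  trace := by rw [iUnion_const, image_circleCurve hr.le, frontier_ball _ hr.ne']
  index_inside a ha := by
    rw [Fin.sum_univ_one, integral_circleCurve (fun z => (z - a)⁻¹),
      circleIntegral.integral_sub_inv_of_mem_ball ha, inv_mul_cancel₀ Complex.two_pi_I_ne_zero]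
  index_outside a ha := by
    rw [closure_ball _ hr.ne'] at ha
    rw [Fin.sum_univ_one, integral_circleCurve (fun z => (z - a)⁻¹),
      circleIntegral_inv_sub_eq_zero hr.le ha, mul_zero]

end Disc

section Existence

variable {V : Type*} [NormedAddCommGroup V] [NormedSpace ℝ V]
  [Module ℍ[ℝ] V] [Module ℍ[ℝ]ᵐᵒᵖ V]
  [IsScalarTower ℝ ℍ[ℝ] V] [IsScalarTower ℝ ℍ[ℝ]ᵐᵒᵖ V]
  [SMulCommClass ℍ[ℝ]ᵐᵒᵖ ℍ[ℝ] V]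
  [NormSMulClass ℍ[ℝ] V] [NormSMulClass ℍ[ℝ]ᵐᵒᵖ V] [CompleteSpace V]
  {T : V →L[ℍ[ℝ]ᵐᵒᵖ] V} {R : ℝ}

theorem isClosed_sSpectrum (T : V →L[ℍ[ℝ]ᵐᵒᵖ] V) : IsClosed (sSpectrum T) := by
  have continuous_quadOp : Continuous (quadOp T) := by
    unfold quadOp
    exact (continuous_const.sub ((continuous_const.mul Quaternion.continuous_re).smul
      continuous_const)).add ((continuous_norm.pow 2).smul continuous_const)
  exact (Units.isOpen.preimage continuous_quadOp).isClosed_compl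

theorem exists_isAdmissible (hR : 0 < R) (hσ : sSpectrum T ⊆ ball 0 R) (I : imagUnits) :
    ∃ U : Set ℂ, IsAdmissible T R I U ∧ Nonempty (OrientedBoundary U) := by
  obtain ⟨r, ⟨hr, hrR⟩, sSpectrum_subset⟩ : ∃ r ∈ Ioo 0 R, sSpectrum T ⊆ ball 0 r :=
    exists_pos_lt_subset_ball hR (isClosed_sSpectrum T) hσ
  exact ⟨ball 0 r,
    { isOpen := isOpen_ball
      isBounded := isBounded_ball
      spectrum_subset := fun z hz => slice_mem_ball_iff.1 (sSpectrum_subset hz)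
      closure_subset := fun z hz => slice_mem_ball_iff.2
        (closedBall_subset_ball hrR (closure_ball_subset_closedBall hz)) },
    ⟨circleBoundary hr⟩⟩

end Existence

end SCalculus

end

theorem mainTheorem3 {V : Type*} [NormedAddCommGroup V] [NormedSpace ℝ V] [CompleteSpace V]
    [Module ℍ[ℝ] V] [Module ℍ[ℝ]ᵐᵒᵖ V]
    [IsScalarTower ℝ ℍ[ℝ] V] [IsScalarTower ℝ ℍ[ℝ]ᵐᵒᵖ V]
    [SMulCommClass ℍ[ℝ]ᵐᵒᵖ ℍ[ℝ] V]
    [NormSMulClass ℍ[ℝ] V] [NormSMulClass ℍ[ℝ]ᵐᵒᵖ V]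
    (T : V →L[ℍ[ℝ]ᵐᵒᵖ] V) (f : ℍ[ℝ] → ℍ[ℝ]) (R : ℝ) (hR : 0 < R)
    (hσ : SCalculus.sSpectrum T ⊆ Metric.ball 0 R)
    (hf : SCalculus.IsLeftRegularOn f (Metric.ball 0 R)) :
    -- for every slice there is an admissible set with an oriented boundary
    (∀ I ∈ SCalculus.imagUnits, ∃ U : Set ℂ, SCalculus.IsAdmissible T R I U ∧
      Nonempty (SCalculus.OrientedBoundary U)) ∧
    -- the integral exists
    (∀ I ∈ SCalculus.imagUnits, ∀ U : Set ℂ, SCalculus.IsAdmissible T R I U →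
      ∀ (Γ : SCalculus.OrientedBoundary U) (k : Fin Γ.n),
        IntervalIntegrable (SCalculus.cauchyIntegrand T f I (Γ.γ k)) MeasureTheory.volume 0 1) ∧
    -- the integral depends neither on the imaginary unit nor on the open set
    (∀ I ∈ SCalculus.imagUnits, ∀ I' ∈ SCalculus.imagUnits, ∀ U U' : Set ℂ,
      SCalculus.IsAdmissible T R I U → SCalculus.IsAdmissible T R I' U' →
      ∀ (Γ : SCalculus.OrientedBoundary U) (Γ' : SCalculus.OrientedBoundary U'),
        SCalculus.cauchyIntegral T f I Γ = SCalculus.cauchyIntegral T f I' Γ') := by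
  obtain ⟨a, ha⟩ := hf.exists_hasSum hR
  refine ⟨fun I hI => SCalculus.exists_isAdmissible hR hσ ⟨I, hI⟩, fun I hI U hU Γ k => ?_,
    fun I hI I' hI' U U' hU hU' Γ Γ' => ?_⟩
  · exact SCalculus.IsAdmissible.intervalIntegrable_cauchyIntegrand (I := ⟨I, hI⟩) hU
      hf.1.continuousOn Γ k
  · exact (SCalculus.IsAdmissible.hasSum_cauchyIntegral (I := ⟨I, hI⟩) hU Γ hR (ha ⟨I, hI⟩)).unique
      (SCalculus.IsAdmissible.hasSum_cauchyIntegral (I := ⟨I', hI'⟩) hU' Γ' hR (ha ⟨I', hI'⟩))
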